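/- Terms are built over a signature $\mathcal F$ and a set of variables $\mathcal V$. A rewrite rule is an arbitrary pair of terms $l \to r$ (no variable conditions), and a TRS is a (possibly infinite) set of rewrite rules. For a TRS $\mathcal R$, $\mathcal R_{\mathsf d}$ is the set of its duplicating rules, i.e. the rules $l\to r$ such that some variable occurs more often in $r$ than in $l$, and $\mathcal R_{\mathsf{nd}} = \mathcal R \setminus \mathcal R_{\mathsf d}$. The relation $\to_{\mathcal R_{\mathsf d}/\mathcal R_{\mathsf{nd}}}$ is $\to_{\mathcal R_{\mathsf{nd}}}^* \cdot \to_{\mathcal R_{\mathsf d}} \cdot \to_{\mathcal R_{\mathsf{nd}}}^*$, and $\mathcal R_{\mathsf d}$ terminates relative to $\mathcal R_{\mathsf{nd}}$ if this relation has no infinite chains. A step $s \to^{\pi} t$ with redex pattern $\pi=\langle p, l\to r,\sigma\rangle$ means $l \to r \in \mathcal R$, $s|_p = l\sigma$ and $t = s[r\sigma]_p$. For relations $>$ and $\geqslant$ on a set of labels, a labeling is a function $\ell$ from rewrite steps (used forwards, $s \to^\pi t$, or backwards, $t \mathrel{{}^{\pi}{\leftarrow}} s$) to labels such that for all contexts $C$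 with hole position $q$ and all substitutions $\sigma$: $\ell(s\to^{\pi_1}t) > \ell(u\to^{\pi_2}v)$ implies $\ell(C[s\sigma]\to^{C[\pi_1\sigma]}C[t\sigma]) > \ell(C[u\sigma]\to^{C[\pi_2\sigma]}C[v\sigma])$, the same with $\geqslant$ in place of $>$, and $\ell(s\to^\pi t)=\ell(t\mathrel{{}^{\pi}{\leftarrow}}s)$; here $C[\pi\sigma]=\langle qp,l\to r,\tau\sigma\rangle$ for $\pi=\langle p,l\to r,\tau\rangle$. A local peak $t \mathrel{{}^{\pi_1}{\leftarrow}} s \to^{\pi_2} u$, with $\pi_1=\langle p,l_1\to r_1,\sigma_1\rangle$ and $\pi_2=\langle q,l_2\to r_2,\sigma_2\rangle$, is a parallel peak if neither of $p,q$ is a prefix of the other, and a variable peak if $p = qq'$ for some $q'$ that is not a function symbol position of $l_2$. With $\alpha = \ell(t \mathrel{{}^{\pi_1}{\leftarrow}} s)$ and $\beta=\ell(s\to^{\pi_2}u)$, it is extended locally decreasing (for $\ell$, $>$, $\geqslant$) if there are terms and $\mathcal R$-steps $$t \leftrightarrow^* t' \to^= t'' \leftrightarrow^* u'' \mathrel{{}^={\leftarrow}}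 u' \leftrightarrow^* u$$ such that every label $\gamma$ in the five successive parts satisfies, respectively, $\alpha>\gamma$; $\beta\geqslant\gamma$; $\alpha>\gamma$ or $\beta>\gamma$; $\alpha\geqslant\gamma$; $\beta>\gamma$. A labeling is compatible with $\mathcal R$ if all parallel peaks and all variable peaks of $\mathcal R$ are extended locally decreasing for it. The source labeling is $\ell^{\mathsf{src}}(s\to^\pi t)=\ell^{\mathsf{src}}(t\mathrel{{}^{\pi}{\leftarrow}}s)=s$; its labels (terms) are compared by ${>} = {\to_{\mathcal R_{\mathsf d}/\mathcal R_{\mathsf{nd}}}^+}$ and ${\geqslant} = {\to_{\mathcal R}^*}$. **Lemma.** Let $\mathcal R$ be a left-linear TRS (no variable occurs twice in a left-hand side) such that $\mathcal R_{\mathsf d}$ terminates relative to $\mathcal R_{\mathsf{nd}}$. Then $>$ is a well-founded order, $\geqslant$ is a preorder, and ${\geqslant}\cdot{>}\cdot{\geqslant}\subseteq{>}$. Moreover, with these relations: 1. the source labeling is a labeling; 2. parallel peaks of $\mathcal R$ are extended locally decreasing for the source labeling; 3. variable peaks of $\mathcal R$ are extended locally decreasing for the source labeling; 4. the source labeling is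 compatible with $\mathcal R$. -/

import Mathlib

/-!  Terms over a signature and a set of variables are `L.Term V`; the function symbols of arity `n`
are `L.Functions n` (the relation symbols of `L` play no role). -/

universe u v w x

namespace TermRewriting

variable {L : FirstOrder.Language.{u, v}} {V : Type w}

/-- Positions are strings of positive natural numbers; `q ≤ p` is `q <+: p`. -/
abbrev Position : Type := List ℕ+

/-- Substitutions; `tσ` is `t.subst σ`. -/
abbrev Subst (L : FirstOrder.Language.{u, v}) (V : Type w) : Type (max u w) := V → L.Term V

/-- The subterm `t|_p`, which is `none` if `p` is not a position of `t`. -/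
def subtermAt : L.Term V → Position → Option (L.Term V)
  | t, [] => some t
  | .var _, _ :: _ => none
  | @FirstOrder.Language.Term.func _ _ n _ ts, i :: p =>
      if h : i.natPred < n then subtermAt (ts ⟨i.natPred, h⟩) p else none

/-- `t[u]_p`: replace the subterm of `t` at position `p` by `u`
(nothing happens if `p` is not a position of `t`). -/
def replaceAt : L.Term V → Position → L.Term V → L.Term V
  | _, [], u => u
  | .var y, _ :: _, _ => .var y
  | .func f ts, i :: p, u =>
      .func f (fun j => if (j : ℕ) = i.natPred then replaceAt (ts j) p u else ts j)

/-- The set of function symbol positions of `t`. -/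
def FPos (t : L.Term V) : Set Position :=
  {p | ∃ (n : ℕ) (f : L.Functions n) (ts : Fin n → L.Term V),
    subtermAt t p = some (FirstOrder.Language.Term.func f ts)}

open Classical in
/-- `|t|_y`: the number of occurrences of the variable `y` in `t`. -/
noncomputable def occ (y : V) : L.Term V → ℕ
  | .var z => if z = y then 1 else 0
  | .func _ ts => ∑ j, occ y (ts j)

/-- Contexts. In `arg f i ts C` the `i`-th argument of `f` is the context `C` and the other
arguments are given by `ts` (the value `ts i` is ignored). -/
inductive Context (L : FirstOrder.Language.{u, v}) (V : Type w) : Type (max u w)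
  | hole : Context L V
  | arg {n : ℕ} (f : L.Functions n) (i : Fin n) (ts : Fin n → L.Term V) (C : Context L V) :
      Context L V

/-- `C[t]`: fill the hole of `C` with `t`. -/
def Context.fill : Context L V → L.Term V → L.Term V
  | .hole, t => t
  | .arg f i ts C, t => .func f (fun j => if j = i then C.fill t else ts j)

/-- The position of the hole of `C`. -/
def Context.holePos : Context L V → Position
  | .hole => []
  | .arg _ i _ C => Nat.succPNat i :: C.holePos

/-- Rewrite rules `lhs → rhs`; no variable conditions are imposed. -/
structure Rule (L : FirstOrder.Language.{u, v}) (V : Type w) where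
  lhs : L.Term V
  rhs : L.Term V

/-- A term rewrite system is a (possibly infinite) set of rewrite rules. -/
abbrev TRS (L : FirstOrder.Language.{u, v}) (V : Type w) : Type (max u w) := Set (Rule L V)

/-- A rule is duplicating if some variable occurs more often on the right than on the left. -/
def Rule.Duplicating (ρ : Rule L V) : Prop := ∃ y, occ y ρ.lhs < occ y ρ.rhs

/-- The duplicating rules of `R`. -/
def dup (R : TRS L V) : TRS L V := {ρ ∈ R | ρ.Duplicating}

/-- The non-duplicating rules of `R`. -/
def nondup (R : TRS L V) : TRS L V := {ρ ∈ R | ¬ ρ.Duplicating}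

/-- No variable occurs more than once in a left-hand side. -/
def LeftLinear (R : TRS L V) : Prop := ∀ ρ ∈ R, ∀ y, occ y ρ.lhs ≤ 1

/-- Redex patterns `⟨p, l → r, σ⟩`. -/
structure RedexPattern (L : FirstOrder.Language.{u, v}) (V : Type w) where
  pos : Position
  rule : Rule L V
  sub : Subst L V

/-- The step `s →^π t` of `R`. -/
def StepWith (R : TRS L V) (s : L.Term V) (π : RedexPattern L V) (t : L.Term V) : Prop :=
  π.rule ∈ R ∧ subtermAt s π.pos = some (π.rule.lhs.subst π.sub) ∧
    t = replaceAt s π.pos (π.rule.rhs.subst π.sub)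

/-- The rewrite relation `→_R`. -/
def Rew (R : TRS L V) (s t : L.Term V) : Prop := ∃ π, StepWith R s π t

/-- The relative rewrite relation `→_{R/S} = →_S^* · →_R · →_S^*`. -/
def RelRew (R S : TRS L V) : L.Term V → L.Term V → Prop :=
  Relation.Comp (Relation.ReflTransGen (Rew S))
    (Relation.Comp (Rew R) (Relation.ReflTransGen (Rew S)))

/-- A relation `>` is well-founded in the sense of rewriting: there is no infinite chain
`a₀ > a₁ > ⋯`. -/
def Terminating {A : Type x} (gt : A → A → Prop) : Prop := WellFounded (fun a b => gt b a)

/-- `R` is terminating relative to `S`. -/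
def TerminatesRelativeTo (R S : TRS L V) : Prop := Terminating (RelRew R S)

/-- A rewrite step `source →^pattern target` together with the direction in which it is used:
`forward = true` stands for `source → target` and `forward = false` for `target ← source`. -/
structure Step (L : FirstOrder.Language.{u, v}) (V : Type w) where
  source : L.Term V
  pattern : RedexPattern L V
  target : L.Term V
  forward : Bool

/-- The data of `a` form a rewrite step of `R`. -/
def Step.Valid (R : TRS L V) (a : Step L V) : Prop := StepWith R a.source a.pattern a.target

/-- `C[πσ] = ⟨qp, l → r, τσ⟩` for `π = ⟨p, l → r, τ⟩` and `q` the hole position of `C`. -/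
def RedexPattern.lift (C : Context L V) (σ : Subst L V) (π : RedexPattern L V) :
    RedexPattern L V :=
  ⟨C.holePos ++ π.pos, π.rule, fun y => (π.sub y).subst σ⟩

/-- `C[sσ] →^{C[πσ]} C[tσ]` for a step `s →^π t`, used in the same direction. -/
def Step.lift (C : Context L V) (σ : Subst L V) (a : Step L V) : Step L V :=
  ⟨C.fill (a.source.subst σ), a.pattern.lift C σ, C.fill (a.target.subst σ), a.forward⟩

section Labels

variable {Λ : Type x}

/-- `ℓ` is a labeling of the rewrite steps of `R`, for the relations `>` and `≥` on labels. -/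
structure IsLabeling (R : TRS L V) (gt ge : Λ → Λ → Prop) (lab : Step L V → Λ) : Prop where
  gt_lift : ∀ a b : Step L V, a.Valid R → b.Valid R → gt (lab a) (lab b) →
    ∀ (C : Context L V) (σ : Subst L V), gt (lab (a.lift C σ)) (lab (b.lift C σ))
  ge_lift : ∀ a b : Step L V, a.Valid R → b.Valid R → ge (lab a) (lab b) →
    ∀ (C : Context L V) (σ : Subst L V), ge (lab (a.lift C σ)) (lab (b.lift C σ))
  symm : ∀ (s : L.Term V) (π : RedexPattern L V) (t : L.Term V), StepWith R s π t →
    lab ⟨s, π, t, true⟩ = lab ⟨s, π, t, false⟩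

/-- `>` is a well-founded order, `≥` is a preorder, and they are compatible:
`≥ · > · ≥ ⊆ >`. -/
structure IsOrderPair (gt ge : Λ → Λ → Prop) : Prop where
  gt_terminating : Terminating gt
  gt_trans : ∀ a b c, gt a b → gt b c → gt a c
  ge_refl : ∀ a, ge a a
  ge_trans : ∀ a b c, ge a b → ge b c → ge a c
  compat : ∀ a b c d, ge a b → gt b c → ge c d → gt a d

/-- `Conversion R s c t`: the list `c` of steps is a conversion `s ↔_R^* t`. -/
inductive Conversion (R : TRS L V) : L.Term V → List (Step L V) → L.Term V → Prop
  | nil (t : L.Term V) : Conversion R t [] t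
  | fwd {s t u : L.Term V} {π : RedexPattern L V} {c : List (Step L V)} :
      StepWith R s π t → Conversion R t c u → Conversion R s (⟨s, π, t, true⟩ :: c) u
  | bwd {s t u : L.Term V} {π : RedexPattern L V} {c : List (Step L V)} :
      StepWith R s π t → Conversion R s c u → Conversion R t (⟨s, π, t, false⟩ :: c) u

/-- `s →^= t`, as a conversion with at most one step, directed from `s` to `t`. -/
def FwdOpt (R : TRS L V) (s : L.Term V) (c : List (Step L V)) (t : L.Term V) : Prop :=
  Conversion R s c t ∧ c.length ≤ 1 ∧ ∀ a ∈ c, a.forward = true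

/-- `s ←^= t`, as a conversion with at most one step, directed from `t` to `s`. -/
def BwdOpt (R : TRS L V) (s : L.Term V) (c : List (Step L V)) (t : L.Term V) : Prop :=
  Conversion R s c t ∧ c.length ≤ 1 ∧ ∀ a ∈ c, a.forward = false

/-- The set of labels of a conversion. -/
def labels (lab : Step L V → Λ) (c : List (Step L V)) : Set Λ := {β | ∃ a ∈ c, lab a = β}

/-- The set of all `β` such that `α ≽ β` for some `α ∈ S`. -/
def below (rel : Λ → Λ → Prop) (S : Set Λ) : Set Λ := {β | ∃ α ∈ S, rel α β}

/-- The local peak `t ←^{π₁} s →^{π₂} u` of `R`. -/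
def LocalPeak (R : TRS L V) (t : L.Term V) (π₁ : RedexPattern L V) (s : L.Term V)
    (π₂ : RedexPattern L V) (u : L.Term V) : Prop :=
  StepWith R s π₁ t ∧ StepWith R s π₂ u

/-- A local peak whose steps take place at parallel positions. -/
def ParallelPeak (R : TRS L V) (t : L.Term V) (π₁ : RedexPattern L V) (s : L.Term V)
    (π₂ : RedexPattern L V) (u : L.Term V) : Prop :=
  LocalPeak R t π₁ s π₂ u ∧ ¬ π₁.pos <+: π₂.pos ∧ ¬ π₂.pos <+: π₁.pos

/-- A local peak whose left step takes place at or below a variable position of the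
left-hand side of the rule of the right step. -/
def VariablePeak (R : TRS L V) (t : L.Term V) (π₁ : RedexPattern L V) (s : L.Term V)
    (π₂ : RedexPattern L V) (u : L.Term V) : Prop :=
  LocalPeak R t π₁ s π₂ u ∧ ∃ q, π₁.pos = π₂.pos ++ q ∧ q ∉ FPos π₂.rule.lhs

/-- The local peak `t ←^{π₁} s →^{π₂} u` is extended locally decreasing for `ℓ`, `>` and `≥`: there
is a local diagram `t ↔^* t' →^= t'' ↔^* u'' ←^= u' ↔^* u` whose labels are as required. -/
def ExtLocallyDecreasing (R : TRS L V) (gt ge : Λ → Λ → Prop) (lab : Step L V → Λ)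
    (t : L.Term V) (π₁ : RedexPattern L V) (s : L.Term V) (π₂ : RedexPattern L V)
    (u : L.Term V) : Prop :=
  let α := lab ⟨s, π₁, t, false⟩
  let β := lab ⟨s, π₂, u, true⟩
  ∃ (t' t'' u'' u' : L.Term V) (c₁ c₂ c₃ c₄ c₅ : List (Step L V)),
    (Conversion R t c₁ t' ∧ labels lab c₁ ⊆ below gt {α}) ∧
    (FwdOpt R t' c₂ t'' ∧ labels lab c₂ ⊆ below ge {β}) ∧
    (Conversion R t'' c₃ u'' ∧ labels lab c₃ ⊆ below gt {α, β}) ∧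
    (BwdOpt R u'' c₄ u' ∧ labels lab c₄ ⊆ below ge {α}) ∧
    (Conversion R u' c₅ u ∧ labels lab c₅ ⊆ below gt {β})

/-- All parallel peaks of `R` are extended locally decreasing. -/
def ParallelPeaksDecreasing (R : TRS L V) (gt ge : Λ → Λ → Prop) (lab : Step L V → Λ) : Prop :=
  ∀ t π₁ s π₂ u, ParallelPeak R t π₁ s π₂ u → ExtLocallyDecreasing R gt ge lab t π₁ s π₂ u

/-- All variable peaks of `R` are extended locally decreasing. -/
def VariablePeaksDecreasing (R : TRS L V) (gt ge : Λ → Λ → Prop) (lab : Step L V → Λ) : Prop :=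
  ∀ t π₁ s π₂ u, VariablePeak R t π₁ s π₂ u → ExtLocallyDecreasing R gt ge lab t π₁ s π₂ u

/-- `ℓ` is a labeling that is compatible with `R`. -/
def Compatible (R : TRS L V) (gt ge : Λ → Λ → Prop) (lab : Step L V → Λ) : Prop :=
  IsLabeling R gt ge lab ∧ ParallelPeaksDecreasing R gt ge lab ∧
    VariablePeaksDecreasing R gt ge lab

end Labels

/-- The source labeling: a rewrite step `s →^π t` is labeled by its source `s`, whichever way it
is used. -/
def srcLab (a : Step L V) : L.Term V := a.source

/-- The strict order for the source labeling: the transitive closure of the rewrite relation of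
the duplicating rules relative to the non-duplicating ones. -/
def srcGt (R : TRS L V) : L.Term V → L.Term V → Prop :=
  Relation.TransGen (RelRew (dup R) (nondup R))

/-- The weak order for the source labeling: `→_R^*`. -/
def srcGe (R : TRS L V) : L.Term V → L.Term V → Prop := Relation.ReflTransGen (Rew R)

end TermRewriting

/-! A parallel peak closes with one step on each side, and so does a variable peak whose upper rule
is non-duplicating: by left-linearity the variable at which the lower step takes place occurs once
on the left, hence at most once on the right. If the upper rule is duplicating, several steps may be
needed below the upper one, but then the upper step `s → u` is itself a decrease `s > u`, and with
`≥ · > · ≥ ⊆ >` every term reachable from `u` is a label strictly below `s`. -/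

namespace TermRewriting

open FirstOrder.Language Relation

variable {L : FirstOrder.Language.{u, v}} {V : Type w}

section Substitutions

variable {W X : Type*}

theorem subst_subst (σ : V → L.Term W) (τ : W → L.Term X) (t : L.Term V) :
    (t.subst σ).subst τ = t.subst fun y => (σ y).subst τ := by
  induction t with
  | var y => rfl
  | func f ts ih => simp only [Term.subst, ih]

theorem subst_congr {σ τ : V → L.Term W} {t : L.Term V}
    (h : ∀ y, occ y t ≠ 0 → σ y = τ y) : t.subst σ = t.subst τ := by
  induction t with
  | var y => exact h y (by simp [occ])
  | func f ts ih =>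
    have ih' : ∀ j, (ts j).subst σ = (ts j).subst τ := fun j =>
      ih j fun y hy => h y fun h0 => hy (Finset.sum_eq_zero_iff.1 h0 j (Finset.mem_univ j))
    simp only [Term.subst, ih']

theorem subst_update_of_occ_eq_zero [DecidableEq V] (σ : V → L.Term W) {x : V} (a : L.Term W)
    {t : L.Term V} (h : occ x t = 0) : t.subst (Function.update σ x a) = t.subst σ := by
  refine subst_congr fun y hy => ?_
  have hyx : y ≠ x := by
    rintro rfl
    exact hy h
  simp [hyx]

end Substitutions

section Contexts

/-- `Cσ`: the substitution `σ` applied to the arguments of the context `C` beside its hole, so that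
`(C[t])σ = (Cσ)[tσ]`. -/
def Context.subst (σ : Subst L V) : Context L V → Context L V
  | .hole => .hole
  | .arg f i ts C => .arg f i (fun j => (ts j).subst σ) (C.subst σ)

theorem Context.fill_arg_hole {n : ℕ} (f : L.Functions n) (i : Fin n) (ts : Fin n → L.Term V)
    (t : L.Term V) : (Context.arg f i ts .hole).fill t = .func f (Function.update ts i t) :=
  congrArg (Term.func f) (funext fun j => (Function.update_apply ts i t j).symm)

theorem Context.fill_arg_eq_func {n : ℕ} (f : L.Functions n) {i : Fin n} {ts : Fin n → L.Term V}
    {C : Context L V} {t : L.Term V} (h : C.fill t = ts i) :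
    (Context.arg f i ts C).fill t = .func f ts := by
  refine congrArg (Term.func f) (funext fun j => ?_)
  split_ifs with hj
  · rw [h, hj]
  · rfl

theorem Context.fill_subst (σ : Subst L V) (C : Context L V) (t : L.Term V) :
    (C.fill t).subst σ = (C.subst σ).fill (t.subst σ) := by
  induction C with
  | hole => rfl
  | arg f i ts C ih =>
    simp only [Context.fill, Context.subst, Term.subst, ← ih]
    congr 1
    funext j
    exact apply_ite (fun t => Term.subst t σ) (j = i) _ _

@[simp]
theorem Context.holePos_subst (σ : Subst L V) (C : Context L V) :
    (C.subst σ).holePos = C.holePos := by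
  induction C with
  | hole => rfl
  | arg f i ts C ih => simp only [Context.subst, Context.holePos, ih]

theorem exists_fill_var_eq_of_occ_ne_zero {x : V} {t : L.Term V} (h : occ x t ≠ 0) :
    ∃ C : Context L V, C.fill (.var x) = t := by
  induction t with
  | var y =>
    obtain rfl : y = x := by simpa [occ] using h
    exact ⟨.hole, rfl⟩
  | func f ts ih =>
    obtain ⟨i, -, hi⟩ := Finset.exists_ne_zero_of_sum_ne_zero h
    obtain ⟨C, hC⟩ := ih i hi
    exact ⟨.arg f i ts C, Context.fill_arg_eq_func f hC⟩

theorem occ_fill_var_pos (x : V) (C : Context L V) : 0 < occ x (C.fill (.var x)) := by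
  induction C with
  | hole => simp [Context.fill, occ]
  | arg _ i ts C ih =>
    exact Finset.sum_pos' (fun _ _ => Nat.zero_le _) ⟨i, Finset.mem_univ i, by simpa using ih⟩

theorem subst_update_fill_var [DecidableEq V] (σ : Subst L V) {x : V} (a : L.Term V)
    {C : Context L V} (h : occ x (C.fill (.var x)) ≤ 1) :
    (C.fill (.var x)).subst (Function.update σ x a) = (C.subst σ).fill a := by
  induction C with
  | hole => exact Function.update_self x a σ
  | arg _ i ts C ih =>
    have hsum : occ x (C.fill (.var x)) + ∑ j ∈ Finset.univ.erase i, occ x (ts j) ≤ 1 := by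
      rw [Context.fill, occ, ← Finset.add_sum_erase _ _ (Finset.mem_univ i), if_pos rfl] at h
      convert h using 3 with j hj
      rw [if_neg (Finset.ne_of_mem_erase hj)]
    have hpos := occ_fill_var_pos x C
    have hsum_zero : ∑ j ∈ Finset.univ.erase i, occ x (ts j) = 0 := by omega
    have hother : ∀ j ≠ i, occ x (ts j) = 0 := fun j hj =>
      Finset.sum_eq_zero_iff.1 hsum_zero j (Finset.mem_erase.2 ⟨hj, Finset.mem_univ j⟩)
    simp only [Context.fill, Context.subst, Term.subst]
    congr 1
    funext j
    split_ifs with hj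
    · exact ih (by omega)
    · exact subst_update_of_occ_eq_zero σ a (hother j hj)

end Contexts

section Positions

@[simp]
theorem subtermAt_nil (t : L.Term V) : subtermAt t [] = some t := by
  cases t <;> rfl

@[simp]
theorem replaceAt_nil (t u : L.Term V) : replaceAt t [] u = u := by
  cases t <;> rfl

theorem Context.subtermAt_fill_append (C : Context L V) (t : L.Term V) (p : Position) :
    subtermAt (C.fill t) (C.holePos ++ p) = subtermAt t p := by
  induction C with
  | hole => rfl
  | arg f i ts C ih => simp [Context.fill, Context.holePos, subtermAt, ih]

theorem Context.replaceAt_fill_append (C : Context L V) (t u : L.Term V) (p : Position) :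
    replaceAt (C.fill t) (C.holePos ++ p) u = C.fill (replaceAt t p u) := by
  induction C with
  | hole => rfl
  | arg f i ts C ih =>
    simp only [Context.fill, Context.holePos, replaceAt, List.cons_append, Nat.natPred_succPNat,
      Fin.val_inj]
    congr 1
    funext j
    by_cases h : j = i <;> simp [h, ih]

@[simp]
theorem Context.subtermAt_fill (C : Context L V) (t : L.Term V) :
    subtermAt (C.fill t) C.holePos = some t := by
  simpa using C.subtermAt_fill_append t []

@[simp]
theorem Context.replaceAt_fill (C : Context L V) (t u : L.Term V) :
    replaceAt (C.fill t) C.holePos u = C.fill u := by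
  simpa using C.replaceAt_fill_append t u []

theorem exists_fill_eq_of_subtermAt_eq_some {s t : L.Term V} {p : Position}
    (h : subtermAt s p = some t) : ∃ C : Context L V, C.holePos = p ∧ C.fill t = s := by
  induction p generalizing s with
  | nil => exact ⟨.hole, rfl, by simpa [Context.fill, eq_comm] using h⟩
  | cons i p ih =>
    cases s with
    | var y => simp [subtermAt] at h
    | @func n f ts =>
      simp only [subtermAt] at h
      split_ifs at h with hi
      obtain ⟨C, hC, hf⟩ := ih h
      exact ⟨.arg f ⟨i.natPred, hi⟩ ts C, by simp [Context.holePos, hC],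
        Context.fill_arg_eq_func f hf⟩

theorem exists_fill_var_eq_of_notMem_FPos {σ : Subst L V} {t u : L.Term V} {q : Position}
    (hq : q ∉ FPos t) (hu : subtermAt (t.subst σ) q = some u) :
    ∃ (C : Context L V) (x : V) (q' : Position), C.fill (.var x) = t ∧ C.holePos ++ q' = q := by
  induction t generalizing q with
  | var x => exact ⟨.hole, x, q, rfl, rfl⟩
  | @func n f ts ih =>
    cases q with
    | nil => exact absurd ⟨n, f, ts, subtermAt_nil _⟩ hq
    | cons i q =>
      simp only [Term.subst, subtermAt] at hu
      split_ifs at hu with hi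
      have hq' : q ∉ FPos (ts ⟨i.natPred, hi⟩) := fun ⟨m, g, us, h⟩ =>
        hq ⟨m, g, us, by simp [subtermAt, hi, h]⟩
      obtain ⟨C, x, q', hC, rfl⟩ := ih _ hq' hu
      exact ⟨.arg f ⟨i.natPred, hi⟩ ts C, x, q', Context.fill_arg_eq_func f hC,
        by simp [Context.holePos]⟩

theorem subtermAt_replaceAt_of_parallel (s a : L.Term V) {p q : Position}
    (hpq : ¬ p <+: q) (hqp : ¬ q <+: p) :
    subtermAt (replaceAt s p a) q = subtermAt s q := by
  induction p generalizing s q with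
  | nil => simp at hpq
  | cons i p ih =>
    cases q with
    | nil => simp at hqp
    | cons k q =>
      cases s with
      | var y => simp [replaceAt]
      | func f ts =>
        simp only [replaceAt, subtermAt]
        split_ifs with hk hki
        · obtain rfl : k = i := PNat.natPred_injective hki
          rw [List.prefix_cons_inj] at hpq hqp
          exact ih _ hpq hqp
        · rfl
        · rfl

theorem replaceAt_comm_of_parallel (s a b : L.Term V) {p q : Position}
    (hpq : ¬ p <+: q) (hqp : ¬ q <+: p) :
    replaceAt (replaceAt s p a) q b = replaceAt (replaceAt s q b) p a := by
  induction p generalizing s q with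
  | nil => simp at hpq
  | cons i p ih =>
    cases q with
    | nil => simp at hqp
    | cons k q =>
      cases s with
      | var y => simp [replaceAt]
      | func f ts =>
        simp only [replaceAt]
        congr 1
        funext j
        split_ifs with hk hi hi
        · obtain rfl : k = i := PNat.natPred_injective (hk.symm.trans hi)
          rw [List.prefix_cons_inj] at hpq hqp
          exact ih _ hpq hqp
        all_goals rfl

end Positions

section RewriteRelations

/-- Rewrite relations: relations on terms that are closed under contexts and substitutions.
The source labeling is a labeling for any pair of them. -/
structure IsRewriteRelation (rel : L.Term V → L.Term V → Prop) : Prop where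
  fill : ∀ {s t : L.Term V}, rel s t → ∀ C : Context L V, rel (C.fill s) (C.fill t)
  subst : ∀ {s t : L.Term V}, rel s t → ∀ σ : Subst L V, rel (s.subst σ) (t.subst σ)

namespace IsRewriteRelation

variable {rel rel' : L.Term V → L.Term V → Prop}

theorem reflTransGen (h : IsRewriteRelation rel) : IsRewriteRelation (ReflTransGen rel) where
  fill hst C := ReflTransGen.lift C.fill (fun _ _ hab => h.fill hab C) _ _ hst
  subst hst σ := ReflTransGen.lift (·.subst σ) (fun _ _ hab => h.subst hab σ) _ _ hst

theorem reflGen (h : IsRewriteRelation rel) : IsRewriteRelation (ReflGen rel) where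
  fill hst C := by
    cases hst with
    | refl => exact .refl
    | single hst => exact .single (h.fill hst C)
  subst hst σ := by
    cases hst with
    | refl => exact .refl
    | single hst => exact .single (h.subst hst σ)

theorem transGen (h : IsRewriteRelation rel) : IsRewriteRelation (TransGen rel) where
  fill hst C := TransGen.lift C.fill (fun _ _ hab => h.fill hab C) _ _ hst
  subst hst σ := TransGen.lift (·.subst σ) (fun _ _ hab => h.subst hab σ) _ _ hst

theorem comp (h : IsRewriteRelation rel) (h' : IsRewriteRelation rel') :
    IsRewriteRelation (Comp rel rel') where
  fill := fun ⟨_, hsa, hat⟩ C => ⟨_, h.fill hsa C, h'.fill hat C⟩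
  subst := fun ⟨_, hsa, hat⟩ σ => ⟨_, h.subst hsa σ, h'.subst hat σ⟩

end IsRewriteRelation

variable {R : TRS L V}

theorem stepWith_iff_exists_context {s t : L.Term V} {π : RedexPattern L V} :
    StepWith R s π t ↔ π.rule ∈ R ∧ ∃ C : Context L V, C.holePos = π.pos ∧
      C.fill (π.rule.lhs.subst π.sub) = s ∧ C.fill (π.rule.rhs.subst π.sub) = t := by
  refine and_congr_right fun _ => ⟨fun ⟨hs, ht⟩ => ?_, fun ⟨C, hpos, hs, ht⟩ => ?_⟩
  · obtain ⟨C, hpos, rfl⟩ := exists_fill_eq_of_subtermAt_eq_some hs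
    exact ⟨C, hpos, rfl, by rw [ht, ← hpos, C.replaceAt_fill]⟩
  · simp [← hpos, ← hs, ← ht]

theorem rew_of_mem {ρ : Rule L V} (hρ : ρ ∈ R) (C : Context L V) (σ : Subst L V) :
    Rew R (C.fill (ρ.lhs.subst σ)) (C.fill (ρ.rhs.subst σ)) :=
  ⟨⟨C.holePos, ρ, σ⟩, stepWith_iff_exists_context.2 ⟨hρ, C, rfl, rfl, rfl⟩⟩

theorem isRewriteRelation_rew (R : TRS L V) : IsRewriteRelation (Rew R) where
  fill := by
    rintro _ _ ⟨π, hR, hs, rfl⟩ C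
    exact ⟨⟨C.holePos ++ π.pos, π.rule, π.sub⟩, hR, by rw [C.subtermAt_fill_append, hs],
      (C.replaceAt_fill_append _ _ _).symm⟩
  subst := by
    rintro s t ⟨π, h⟩ σ
    obtain ⟨hR, C, -, rfl, rfl⟩ := stepWith_iff_exists_context.1 h
    simpa only [Context.fill_subst, subst_subst] using
      rew_of_mem hR (C.subst σ) fun y => (π.sub y).subst σ

theorem isRewriteRelation_relRew (R S : TRS L V) : IsRewriteRelation (RelRew R S) :=
  have hS := (isRewriteRelation_rew S).reflTransGen
  hS.comp ((isRewriteRelation_rew R).comp hS)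

theorem isLabeling_srcLab {gt ge : L.Term V → L.Term V → Prop} (hgt : IsRewriteRelation gt)
    (hge : IsRewriteRelation ge) : IsLabeling R gt ge srcLab where
  gt_lift _ _ _ _ h C σ := hgt.fill (hgt.subst h σ) C
  ge_lift _ _ _ _ h C σ := hge.fill (hge.subst h σ) C
  symm _ _ _ _ := rfl

end RewriteRelations

section RelativeRewriting

variable {R S : TRS L V} {s t w : L.Term V}

theorem rew_union : Rew (R ∪ S) s t ↔ Rew R s t ∨ Rew S s t := by
  simp only [Rew, StepWith, Set.mem_union, or_and_right, exists_or]

theorem dup_union_nondup (R : TRS L V) : dup R ∪ nondup R = R :=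
  Set.inter_union_compl R {ρ | ρ.Duplicating}

theorem RelRew.of_rew (h : Rew R s t) : RelRew R S s t :=
  ⟨s, .refl, t, h, .refl⟩

theorem transGen_relRew_of_rew_union_left (h : Rew (R ∪ S) s t)
    (htw : TransGen (RelRew R S) t w) : TransGen (RelRew R S) s w := by
  rcases rew_union.1 h with hR | hS
  · exact htw.head (.of_rew hR)
  · obtain ⟨c, ⟨a, hta, hac⟩, hcw⟩ := TransGen.head'_iff.1 htw
    exact TransGen.head' ⟨a, hta.head hS, hac⟩ hcw

theorem transGen_relRew_of_rew_union_right (hst : TransGen (RelRew R S) s t)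
    (h : Rew (R ∪ S) t w) : TransGen (RelRew R S) s w := by
  rcases rew_union.1 h with hR | hS
  · exact hst.tail (.of_rew hR)
  · obtain ⟨c, hsc, a, hca, b, hab, hbt⟩ := TransGen.tail'_iff.1 hst
    exact TransGen.tail' hsc ⟨a, hca, b, hab, hbt.tail hS⟩

theorem transGen_relRew_of_reflTransGen_left (h : ReflTransGen (Rew (R ∪ S)) s t)
    (htw : TransGen (RelRew R S) t w) : TransGen (RelRew R S) s w := by
  induction h using ReflTransGen.head_induction_on with
  | refl => exact htw
  | head h _ ih => exact transGen_relRew_of_rew_union_left h ih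

theorem transGen_relRew_of_reflTransGen_right (hst : TransGen (RelRew R S) s t)
    (h : ReflTransGen (Rew (R ∪ S)) t w) : TransGen (RelRew R S) s w := by
  induction h with
  | refl => exact hst
  | tail _ h ih => exact transGen_relRew_of_rew_union_right ih h

theorem Terminating.transGen {A : Type x} {gt : A → A → Prop} (h : Terminating gt) :
    Terminating (TransGen gt) :=
  Subrelation.wf transGen_swap.2 (WellFounded.transGen h)

theorem TerminatesRelativeTo.isOrderPair (h : TerminatesRelativeTo R S) :
    IsOrderPair (TransGen (RelRew R S)) (ReflTransGen (Rew (R ∪ S))) where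
  gt_terminating := h.transGen
  gt_trans _ _ _ := TransGen.trans
  ge_refl _ := .refl
  ge_trans _ _ _ := ReflTransGen.trans
  compat _ _ _ _ hab hbc hcd :=
    transGen_relRew_of_reflTransGen_right (transGen_relRew_of_reflTransGen_left hab hbc) hcd

theorem srcGt.of_srcGe_right (hst : srcGt R s t) (h : srcGe R t w) : srcGt R s w :=
  transGen_relRew_of_reflTransGen_right hst (by rwa [dup_union_nondup])

theorem isOrderPair_srcGt_srcGe (h : TerminatesRelativeTo (dup R) (nondup R)) :
    IsOrderPair (srcGt R) (srcGe R) := by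
  have hpair := h.isOrderPair
  rwa [dup_union_nondup] at hpair

end RelativeRewriting

section SubstitutionSteps

variable {R : TRS L V}

theorem reflTransGen_rew_func {n : ℕ} (f : L.Functions n) {ts us : Fin n → L.Term V}
    (h : ∀ j, ReflTransGen (Rew R) (ts j) (us j)) :
    ReflTransGen (Rew R) (.func f ts) (.func f us) := by
  suffices H : ∀ I : Finset (Fin n),
      ReflTransGen (Rew R) (.func f ts) (.func f (I.piecewise us ts)) by
    simpa using H Finset.univ
  intro I
  induction I using Finset.induction_on with
  | empty => simpa using ReflTransGen.refl
  | insert i I hi ih =>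
    have hstep := (isRewriteRelation_rew R).reflTransGen.fill (h i)
      (.arg f i (I.piecewise us ts) .hole)
    have hold : Function.update (I.piecewise us ts) i (ts i) = I.piecewise us ts :=
      Function.update_eq_self_iff.2 (Finset.piecewise_eq_of_notMem I us ts hi).symm
    rw [Context.fill_arg_hole, Context.fill_arg_hole, hold, ← Finset.piecewise_insert] at hstep
    exact ih.trans hstep

theorem reflTransGen_rew_subst {σ τ : Subst L V} (h : ∀ y, ReflTransGen (Rew R) (σ y) (τ y))
    (t : L.Term V) : ReflTransGen (Rew R) (t.subst σ) (t.subst τ) := by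
  induction t with
  | var y => exact h y
  | func f ts ih => exact reflTransGen_rew_func f ih

theorem reflTransGen_rew_subst_update [DecidableEq V] {σ : Subst L V} {x : V} {a : L.Term V}
    (h : Rew R (σ x) a) (t : L.Term V) :
    ReflTransGen (Rew R) (t.subst σ) (t.subst (Function.update σ x a)) := by
  refine reflTransGen_rew_subst (fun y => ?_) t
  rcases eq_or_ne y x with rfl | hy
  · simpa using ReflTransGen.single h
  · simpa [hy] using ReflTransGen.refl

theorem reflGen_rew_subst_update_of_occ_le_one [DecidableEq V] {σ : Subst L V} {x : V}
    {a : L.Term V} (h : Rew R (σ x) a) {t : L.Term V} (ht : occ x t ≤ 1) :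
    ReflGen (Rew R) (t.subst σ) (t.subst (Function.update σ x a)) := by
  by_cases h0 : occ x t = 0
  · rw [subst_update_of_occ_eq_zero σ a h0]
  · obtain ⟨C, rfl⟩ := exists_fill_var_eq_of_occ_ne_zero h0
    rw [subst_update_fill_var σ a ht, C.fill_subst σ]
    exact .single ((isRewriteRelation_rew R).fill h _)

end SubstitutionSteps

section LocalDiagrams

variable {R : TRS L V} {s t u v : L.Term V} {gt ge : L.Term V → L.Term V → Prop}

@[simp]
theorem labels_nil {Λ : Type x} (lab : Step L V → Λ) : labels lab [] = ∅ := by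
  simp [labels]

theorem labels_srcLab_subset_below_singleton {rel : L.Term V → L.Term V → Prop}
    {c : List (Step L V)} : labels srcLab c ⊆ below rel {s} ↔ ∀ a ∈ c, rel s a.source := by
  simp [labels, below, srcLab, Set.subset_def]

theorem exists_fwdOpt_of_reflGen (h : ReflGen (Rew R) s t) :
    ∃ c, FwdOpt R s c t ∧ ∀ a ∈ c, a.source = s := by
  cases h with
  | refl => exact ⟨[], ⟨.nil _, by simp, by simp⟩, by simp⟩
  | single h =>
    obtain ⟨π, hπ⟩ := h
    exact ⟨_, ⟨.fwd hπ (.nil _), by simp, by simp⟩, by simp⟩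

theorem exists_bwdOpt_of_reflGen (h : ReflGen (Rew R) s t) :
    ∃ c, BwdOpt R t c s ∧ ∀ a ∈ c, a.source = s := by
  cases h with
  | refl => exact ⟨[], ⟨.nil _, by simp, by simp⟩, by simp⟩
  | single h =>
    obtain ⟨π, hπ⟩ := h
    exact ⟨_, ⟨.bwd hπ (.nil _), by simp, by simp⟩, by simp⟩

theorem exists_conversion_of_reflTransGen (h : ReflTransGen (Rew R) s t) :
    ∃ c, Conversion R t c s ∧ ∀ a ∈ c, ReflTransGen (Rew R) s a.source := by
  induction h with
  | refl => exact ⟨[], .nil _, by simp⟩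
  | tail hsb hbt ih =>
    obtain ⟨c, hc, hsource⟩ := ih
    obtain ⟨π, hπ⟩ := hbt
    exact ⟨_, .bwd hπ hc, by simpa using ⟨hsb, hsource⟩⟩

theorem extLocallyDecreasing_srcLab_of_reflGen {π₁ π₂ : RedexPattern L V}
    (hst : ge s t) (hsu : ge s u) (htv : ReflGen (Rew R) t v) (huv : ReflGen (Rew R) u v) :
    ExtLocallyDecreasing R gt ge srcLab t π₁ s π₂ u := by
  obtain ⟨c₂, hc₂, h₂⟩ := exists_fwdOpt_of_reflGen htv
  obtain ⟨c₄, hc₄, h₄⟩ := exists_bwdOpt_of_reflGen huv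
  refine ⟨t, v, v, u, [], c₂, [], c₄, [], ⟨.nil _, by simp⟩, ⟨hc₂, ?_⟩, ⟨.nil _, by simp⟩,
    ⟨hc₄, ?_⟩, ⟨.nil _, by simp⟩⟩
  · exact labels_srcLab_subset_below_singleton.2 fun a ha => (h₂ a ha).symm ▸ hst
  · exact labels_srcLab_subset_below_singleton.2 fun a ha => (h₄ a ha).symm ▸ hsu

theorem extLocallyDecreasing_srcLab_of_reflTransGen {π₁ π₂ : RedexPattern L V}
    (hst : ge s t) (hsu : ∀ w, ReflTransGen (Rew R) u w → gt s w)
    (htv : ReflGen (Rew R) t v) (huv : ReflTransGen (Rew R) u v) :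
    ExtLocallyDecreasing R gt ge srcLab t π₁ s π₂ u := by
  obtain ⟨c₂, hc₂, h₂⟩ := exists_fwdOpt_of_reflGen htv
  obtain ⟨c₅, hc₅, h₅⟩ := exists_conversion_of_reflTransGen huv
  refine ⟨t, v, v, v, [], c₂, [], [], c₅, ⟨.nil _, by simp⟩, ⟨hc₂, ?_⟩, ⟨.nil _, by simp⟩,
    ⟨⟨.nil _, by simp, by simp⟩, by simp⟩, ⟨hc₅, ?_⟩⟩
  · exact labels_srcLab_subset_below_singleton.2 fun a ha => (h₂ a ha).symm ▸ hst
  · exact labels_srcLab_subset_below_singleton.2 fun a ha => hsu _ (h₅ a ha)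

end LocalDiagrams

section Peaks

variable {R S : TRS L V} {s t u : L.Term V} {π₁ π₂ : RedexPattern L V}

theorem StepWith.of_parallel (h₁ : StepWith R s π₁ t) (h₂ : StepWith S s π₂ u)
    (h₁₂ : ¬ π₁.pos <+: π₂.pos) (h₂₁ : ¬ π₂.pos <+: π₁.pos) :
    StepWith S t π₂ (replaceAt t π₂.pos (π₂.rule.rhs.subst π₂.sub)) := by
  refine ⟨h₂.1, ?_, rfl⟩
  rw [h₁.2.2, subtermAt_replaceAt_of_parallel _ _ h₁₂ h₂₁, h₂.2.1]

theorem ParallelPeak.exists_common_reduct (h : ParallelPeak R t π₁ s π₂ u) :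
    ∃ v, StepWith R t π₂ v ∧ StepWith R u π₁ v := by
  obtain ⟨⟨h₁, h₂⟩, h₁₂, h₂₁⟩ := h
  refine ⟨_, h₁.of_parallel h₂ h₁₂ h₂₁, ?_⟩
  rw [h₁.2.2, replaceAt_comm_of_parallel _ _ _ h₁₂ h₂₁, ← h₂.2.2]
  exact h₂.of_parallel h₁ h₂₁ h₁₂

theorem parallelPeaksDecreasing_srcLab (gt : L.Term V → L.Term V → Prop) :
    ParallelPeaksDecreasing R gt (srcGe R) srcLab := by
  intro t π₁ s π₂ u h
  obtain ⟨v, htv, huv⟩ := h.exists_common_reduct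
  exact extLocallyDecreasing_srcLab_of_reflGen (.single ⟨π₁, h.1.1⟩) (.single ⟨π₂, h.1.2⟩)
    (.single ⟨π₂, htv⟩) (.single ⟨π₁, huv⟩)

theorem VariablePeak.exists_update [DecidableEq V] (h : VariablePeak R t π₁ s π₂ u)
    (hlin : ∀ y, occ y π₂.rule.lhs ≤ 1) :
    ∃ (D : Context L V) (x : V) (a : L.Term V), Rew R (π₂.sub x) a ∧
      D.fill (π₂.rule.lhs.subst (Function.update π₂.sub x a)) = t ∧
      D.fill (π₂.rule.rhs.subst π₂.sub) = u := by
  obtain ⟨⟨⟨hR₁, hs₁, rfl⟩, h₂⟩, q, hpos, hq⟩ := h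
  obtain ⟨-, D, hD, rfl, rfl⟩ := stepWith_iff_exists_context.1 h₂
  rw [hpos, ← hD, D.subtermAt_fill_append] at hs₁
  obtain ⟨C, x, q', hC, rfl⟩ := exists_fill_var_eq_of_notMem_FPos hq hs₁
  have hlhs : π₂.rule.lhs.subst π₂.sub = (C.subst π₂.sub).fill (π₂.sub x) := by
    rw [← hC, C.fill_subst, Term.subst]
  rw [hlhs, ← C.holePos_subst π₂.sub, Context.subtermAt_fill_append] at hs₁
  refine ⟨D, x, replaceAt (π₂.sub x) q' (π₁.rule.rhs.subst π₁.sub),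
    ⟨⟨q', π₁.rule, π₁.sub⟩, hR₁, hs₁, rfl⟩, ?_, rfl⟩
  rw [hpos, ← hD, D.replaceAt_fill_append, hlhs, ← C.holePos_subst π₂.sub,
    Context.replaceAt_fill_append, ← hC, subst_update_fill_var _ _ (hC ▸ hlin x)]

theorem variablePeaksDecreasing_srcLab (hlin : LeftLinear R) :
    VariablePeaksDecreasing R (srcGt R) (srcGe R) srcLab := by
  classical
  intro t π₁ s π₂ u h
  have hst : srcGe R s t := .single ⟨π₁, h.1.1⟩
  have hsu : StepWith R s π₂ u := h.1.2
  obtain ⟨D, x, a, hxa, rfl, rfl⟩ := h.exists_update (hlin _ hsu.1)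
  have htv := rew_of_mem hsu.1 D (Function.update π₂.sub x a)
  by_cases hd : π₂.rule.Duplicating
  · have hgt : srcGt R s (D.fill (π₂.rule.rhs.subst π₂.sub)) :=
      .single (.of_rew ⟨π₂, ⟨hsu.1, hd⟩, hsu.2⟩)
    exact extLocallyDecreasing_srcLab_of_reflTransGen hst (fun _ => hgt.of_srcGe_right)
      (.single htv) ((isRewriteRelation_rew R).reflTransGen.fill
        (reflTransGen_rew_subst_update hxa π₂.rule.rhs) D)
  · have hocc : occ x π₂.rule.rhs ≤ 1 :=
      (not_lt.1 fun hlt => hd ⟨x, hlt⟩).trans (hlin _ hsu.1 x)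
    exact extLocallyDecreasing_srcLab_of_reflGen hst (.single ⟨π₂, hsu⟩) (.single htv)
      ((isRewriteRelation_rew R).reflGen.fill
        (reflGen_rew_subst_update_of_occ_le_one hxa hocc) D)

end Peaks

end TermRewriting

theorem mainTheorem9 {L : FirstOrder.Language.{u, v}} {V : Type w}
    (R : TermRewriting.TRS L V) (hlin : TermRewriting.LeftLinear R)
    (hterm : TermRewriting.TerminatesRelativeTo
      (TermRewriting.dup R) (TermRewriting.nondup R)) :
    TermRewriting.IsOrderPair (TermRewriting.srcGt R) (TermRewriting.srcGe R) ∧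
    TermRewriting.IsLabeling R (TermRewriting.srcGt R) (TermRewriting.srcGe R)
      TermRewriting.srcLab ∧
    TermRewriting.ParallelPeaksDecreasing R (TermRewriting.srcGt R) (TermRewriting.srcGe R)
      TermRewriting.srcLab ∧
    TermRewriting.VariablePeaksDecreasing R (TermRewriting.srcGt R) (TermRewriting.srcGe R)
      TermRewriting.srcLab ∧
    TermRewriting.Compatible R (TermRewriting.srcGt R) (TermRewriting.srcGe R)
      TermRewriting.srcLab := by
  have hlabeling : TermRewriting.IsLabeling R (TermRewriting.srcGt R) (TermRewriting.srcGe R)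
      TermRewriting.srcLab :=
    TermRewriting.isLabeling_srcLab (TermRewriting.isRewriteRelation_relRew _ _).transGen
      (TermRewriting.isRewriteRelation_rew R).reflTransGen
  have hparallel := TermRewriting.parallelPeaksDecreasing_srcLab (R := R) (TermRewriting.srcGt R)
  have hvariable := TermRewriting.variablePeaksDecreasing_srcLab hlin
  exact ⟨TermRewriting.isOrderPair_srcGt_srcGe hterm, hlabeling, hparallel, hvariable,
    hlabeling, hparallel, hvariable⟩
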